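/- Let $g:[0,1]\times\mathbb{R}^3\to\mathbb{R}$ be continuous, $\delta\in\mathbb{R}$ with $\delta\neq 1$, and $\eta\in(0,1)$. Put $$F(\delta,\eta)=\frac{1}{2(\delta-1)^2}\left[\delta^2(1-\eta)^2+(\delta^2-2\delta)\eta^2+1\right],$$ and let $C(\delta,\eta)=\min\{\sqrt{F(\delta,\eta)},\,2/\pi\}$ if $\delta\le 0$ and $C(\delta,\eta)=\sqrt{F(\delta,\eta)}$ if $\delta>0$. For $\ell\ge 0$ let $\mathcal{Z}(\ell)$ be the set of functions $h:[0,1]\to[0,\infty)$ that are Lebesgue integrable on each closed interval contained in $(0,1]$ and satisfy $\int_t^1 h(s)\,ds\le \ell/t$ for all $0<t<1$. Let $W^{2,2}[0,1]$ be the set of $x:[0,1]\to\mathbb{R}$ such that $x$ and $x'$ are absolutely continuous on $[0,1]$ and $x''\in L^2[0,1]$. Assume: $(H_1)$ There are constants $K_2,K_3,\ell\ge 0$ and a function $k_1:[0,1]\to\mathbb{R}$ with $k_1^2\in\mathcal{Z}(\ell)$ such that $$|g(t,u_1,u_2,u_3)-g(t,v_1,v_2,v_3)|\le k_1(t)|u_1-v_1|+K_2|u_2-v_2|+K_3|u_3-v_3|$$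 for all $t\in[0,1]$ and $u_i,v_i\in\mathbb{R}$, $i=1,2,3$, and $(2\sqrt{\ell}+K_2)\,C(\delta,\eta)+K_3\le 1$. $(H_2)$ There are constants $A_2,A_3,m\ge 0$ and functions $a_1,a_4:[0,1]\to\mathbb{R}$ with $a_1^2\in\mathcal{Z}(m)$ and $a_4\in L^2[0,1]$ such that $(2\sqrt{m}+A_2)\,C(\delta,\eta)+A_3<1$ and $$|g(t,u_1,u_2,u_3)|\le a_1(t)|u_1|+A_2|u_2|+A_3|u_3|+a_4(t)$$ for all $t\in[0,1]$ and $u_i\in\mathbb{R}$, $i=1,2,3$. Then there is $x\in W^{2,2}[0,1]\subseteq C^1[0,1]$ such that $x''(t)=g(t,x(t),x'(t),x''(t))$ for almost every $t\in[0,1]$, $x(0)=0$ and $x'(1)=\delta x'(\eta)$. -/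

import Mathlib

open MeasureTheory Set

noncomputable section

namespace ThreePointBVP

/-- The compact unit interval `[0,1]`, as a subset of the real line. -/
abbrev I : Set ℝ := Icc (0 : ℝ) 1

/-- The derivative of a function on `[0,1]` (one-sided at the end points); only the values of the
function on `[0,1]` matter at points of `[0,1]`. -/
def D (x : ℝ → ℝ) : ℝ → ℝ := derivWithin x I

/-- `x ∈ L²[0,1]`. -/
def MemL2 (x : ℝ → ℝ) : Prop := MemLp x 2 (volume.restrict I)

/-- `x ∈ W^{2,2}[0,1]`: `x` is differentiable on `[0,1]`, both `x` and `x'` are absolutely continuous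
on `[0,1]`, and `x''` (which then exists almost everywhere) belongs to `L²[0,1]`. -/
structure MemW22 (x : ℝ → ℝ) : Prop where
  differentiableOn : DifferentiableOn ℝ x I
  absCont : AbsolutelyContinuousOnInterval x 0 1
  absCont_deriv : AbsolutelyContinuousOnInterval (D x) 0 1
  memL2_deriv2 : MemL2 (D (D x))

/-- The class `𝒵(ℓ)`: non-negative functions on `[0,1]`, Lebesgue integrable on each closed interval
contained in `(0,1]`, with `∫_t^1 h ≤ ℓ / t` for all `0 < t < 1`. -/
structure MemZ (ℓ : ℝ) (h : ℝ → ℝ) : Prop where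
  nonneg : ∀ t ∈ I, 0 ≤ h t
  integrableOn : ∀ a b : ℝ, Icc a b ⊆ Ioc (0 : ℝ) 1 → IntegrableOn h (Icc a b) volume
  integral_le : ∀ t ∈ Ioo (0 : ℝ) 1, ∫ s in t..1, h s ≤ ℓ / t

/-- The expression `F(δ,η)`. -/
def F (δ η : ℝ) : ℝ :=
  1 / (2 * (δ - 1) ^ 2) * (δ ^ 2 * (1 - η) ^ 2 + (δ ^ 2 - 2 * δ) * η ^ 2 + 1)

/-- The constant `C(δ,η)`. -/
def C (δ η : ℝ) : ℝ :=
  if δ ≤ 0 then min (Real.sqrt (F δ η)) (2 / Real.pi) else Real.sqrt (F δ η)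

/-- The Lipschitz-type condition `(H₁)`. -/
def H1 (δ η : ℝ) (g : ℝ → ℝ → ℝ → ℝ → ℝ) : Prop :=
  ∃ (K₂ K₃ ℓ : ℝ) (k₁ : ℝ → ℝ), 0 ≤ K₂ ∧ 0 ≤ K₃ ∧ 0 ≤ ℓ ∧
    MemZ ℓ (fun t => k₁ t ^ 2) ∧
    (∀ t ∈ I, ∀ u₁ u₂ u₃ v₁ v₂ v₃ : ℝ,
      |g t u₁ u₂ u₃ - g t v₁ v₂ v₃| ≤ k₁ t * |u₁ - v₁| + K₂ * |u₂ - v₂| + K₃ * |u₃ - v₃|) ∧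
    (2 * Real.sqrt ℓ + K₂) * C δ η + K₃ ≤ 1

/-- The growth condition `(H₂)`. -/
def H2 (δ η : ℝ) (g : ℝ → ℝ → ℝ → ℝ → ℝ) : Prop :=
  ∃ (A₂ A₃ m : ℝ) (a₁ a₄ : ℝ → ℝ), 0 ≤ A₂ ∧ 0 ≤ A₃ ∧ 0 ≤ m ∧
    MemZ m (fun t => a₁ t ^ 2) ∧ MemL2 a₄ ∧
    (2 * Real.sqrt m + A₂) * C δ η + A₃ < 1 ∧
    (∀ t ∈ I, ∀ u₁ u₂ u₃ : ℝ,
      |g t u₁ u₂ u₃| ≤ a₁ t * |u₁| + A₂ * |u₂| + A₃ * |u₃| + a₄ t)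

/-- `x` is a solution in `W^{2,2}[0,1]` of the three-point boundary value problem
`x'' = g(t, x, x', x'')` a.e. on `[0,1]`, `x(0) = 0`, `x'(1) = δ x'(η)`. -/
structure IsSolution (δ η : ℝ) (g : ℝ → ℝ → ℝ → ℝ → ℝ) (x : ℝ → ℝ) : Prop where
  memW22 : MemW22 x
  equation : ∀ᵐ t ∂(volume.restrict I), D (D x) t - g t (x t) (D x t) (D (D x) t) = 0
  left_bc : x 0 = 0
  right_bc : D x 1 = δ * D x η

end ThreePointBVP

end

/-! Take `y = x''` in `L²[0,1]` as the unknown. The linear problem `x'' = y` with the given boundary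
conditions has the solution `X y`, whose derivative is `V y`, so the task is to find a fixed point
of `N y = g(·, X y, V y, y)`.

Two linear estimates carry the proof. Since `X y` vanishes at 0, a Hardy inequality for weights in
`𝒵(ℓ)` gives `‖k · X y‖ ≤ 2√ℓ ‖V y‖` whenever `k² ∈ 𝒵(ℓ)`. Next, `‖V y‖ ≤ C(δ,η) ‖y‖`: `√F` is the
Hilbert–Schmidt norm of the kernel of `V`, and for `δ ≤ 0` the function `V y` has a zero, so
Wirtinger's constant `2/π` is available too. Hardy and Wirtinger both come from one Schur test.

By linearity, `(H₁)` makes `N` nonexpansive, which alone need not give a fixed point. `(H₂)` gives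
`‖N y‖ ≤ α‖y‖ + b` with `α < 1`, which bounds the solutions of `N y = (1 + l) y` as `l ↓ 0`. Hilbert
space geometry then makes them converge in norm, to a fixed point of `N`. -/

namespace ThreePointBVP

/-! ### Fixed points of nonexpansive maps -/

open Filter Topology in
/-- A nonexpansive self-map of a Hilbert space whose growth is at most affine with slope less than
one has a fixed point. -/
theorem exists_fixedPoint_of_nonexpansive {E : Type*} [NormedAddCommGroup E]
    [InnerProductSpace ℝ E] [CompleteSpace E] (N : E → E) (hN : LipschitzWith 1 N)
    {α b : ℝ} (hα : α < 1) (hb : ∀ y, ‖N y‖ ≤ α * ‖y‖ + b) : ∃ y, N y = y := by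
  have hex : ∀ l : ℝ, 0 < l → ∃ y, N y = (1 + l) • y := by
    intro l hl
    have hl1 : (0 : ℝ) < 1 + l := by linarith
    have hc : ContractingWith (Real.toNNReal (1 + l)⁻¹) (fun y => (1 + l)⁻¹ • N y) := by
      refine ⟨?_, LipschitzWith.of_dist_le_mul fun u v => ?_⟩
      · rw [Real.toNNReal_lt_one]
        exact inv_lt_one_of_one_lt₀ (by linarith)
      · rw [dist_smul₀, Real.coe_toNNReal _ (by positivity), Real.norm_of_nonneg (by positivity)]
        have := hN.dist_le_mul u v
        simp only [NNReal.coe_one, one_mul] at this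
        gcongr
    refine ⟨hc.fixedPoint, ?_⟩
    have h := hc.fixedPoint_isFixedPt
    exact (inv_smul_eq_iff₀ hl1.ne').1 h
  have key : ∀ l m : ℝ, 0 < m → m < l → ∀ u v : E, N u = (1 + l) • u → N v = (1 + m) • v →
      ‖u - v‖ ^ 2 ≤ ‖v‖ ^ 2 - ‖u‖ ^ 2 := by
    intro l m hm hml u v hu hv
    have h1 : inner ℝ (N u - N v) (u - v) ≤ ‖u - v‖ ^ 2 := by
      have h2 := hN.dist_le_mul u v
      rw [NNReal.coe_one, one_mul, dist_eq_norm, dist_eq_norm] at h2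
      calc inner ℝ (N u - N v) (u - v) ≤ ‖N u - N v‖ * ‖u - v‖ := real_inner_le_norm _ _
        _ ≤ ‖u - v‖ * ‖u - v‖ := by gcongr
        _ = _ := by ring
    rw [hu, hv] at h1
    have h3 : ‖u - v‖ ^ 2 = ‖u‖ ^ 2 - 2 * inner ℝ u v + ‖v‖ ^ 2 := norm_sub_sq_real u v
    rw [inner_sub_left, inner_sub_right, inner_sub_right, real_inner_smul_left,
      real_inner_smul_left, real_inner_smul_left, real_inner_smul_left,
      real_inner_self_eq_norm_sq, real_inner_self_eq_norm_sq, real_inner_comm u v] at h1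
    have h4 : 0 ≤ ‖u - v‖ ^ 2 := by positivity
    -- Now `⟪l u - m v, u - v⟫ ≤ 0`; write `2(l u - m v) = (l + m)(u - v) + (l - m)(u + v)`.
    have h5 : (l + m) * ‖u - v‖ ^ 2 ≤ (l - m) * (‖v‖ ^ 2 - ‖u‖ ^ 2) := by
      rw [h3] at h1 ⊢
      nlinarith
    have h6 : 0 ≤ ‖v‖ ^ 2 - ‖u‖ ^ 2 := by
      have : 0 ≤ (l - m) * (‖v‖ ^ 2 - ‖u‖ ^ 2) :=
        le_trans (mul_nonneg (by linarith) h4) h5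
      exact nonneg_of_mul_nonneg_right this (by linarith)
    have h7 : (l + m) * ‖u - v‖ ^ 2 ≤ (l + m) * (‖v‖ ^ 2 - ‖u‖ ^ 2) :=
      h5.trans (by nlinarith)
    exact le_of_mul_le_mul_left h7 (by linarith)
  have hpos : ∀ n : ℕ, (0 : ℝ) < 1 / ((n : ℝ) + 1) := fun n => by positivity
  choose y hy using fun n : ℕ => hex _ (hpos n)
  have hkey : ∀ n m : ℕ, n ≤ m → ‖y n - y m‖ ^ 2 ≤ ‖y m‖ ^ 2 - ‖y n‖ ^ 2 := by
    intro n m hnm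
    rcases hnm.eq_or_lt with rfl | h
    · simp
    · exact key _ _ (hpos m) (Nat.one_div_lt_one_div h) _ _ (hy n) (hy m)
  have hmono : Monotone fun n => ‖y n‖ ^ 2 := fun n m hnm => by
    have := hkey n m hnm
    have h0 : 0 ≤ ‖y n - y m‖ ^ 2 := by positivity
    show ‖y n‖ ^ 2 ≤ ‖y m‖ ^ 2
    linarith
  have hbd : ∀ n, ‖y n‖ ≤ b / (1 - α) := by
    intro n
    have h := hb (y n)
    rw [hy n, norm_smul, Real.norm_of_nonneg (by have := hpos n; linarith)] at h
    rw [le_div_iff₀ (by linarith)]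
    have := mul_nonneg (hpos n).le (norm_nonneg (y n))
    linarith
  have hbdd : BddAbove (range fun n => ‖y n‖ ^ 2) :=
    ⟨(b / (1 - α)) ^ 2, by rintro _ ⟨n, rfl⟩; exact pow_le_pow_left₀ (norm_nonneg _) (hbd n) 2⟩
  -- The squared norms increase to a limit, and `hkey` bounds squared distances by their increments.
  have hcs := (tendsto_atTop_ciSup hmono hbdd).cauchySeq
  have hcauchy : CauchySeq y := by
    rw [Metric.cauchySeq_iff'] at hcs ⊢
    intro ε hε
    obtain ⟨n₀, hn₀⟩ := hcs (ε ^ 2) (by positivity)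
    refine ⟨n₀, fun n hn => ?_⟩
    have h1 := hn₀ n hn
    have h2 := hkey n₀ n hn
    rw [Real.dist_eq] at h1
    rw [dist_comm, dist_eq_norm]
    exact lt_of_pow_lt_pow_left₀ 2 hε.le (h2.trans_lt ((le_abs_self _).trans_lt h1))
  obtain ⟨z, hz⟩ := cauchySeq_tendsto_of_complete hcauchy
  refine ⟨z, tendsto_nhds_unique ((hN.continuous.tendsto z).comp hz) ?_⟩
  have h1 : Tendsto (fun n : ℕ => (1 + 1 / ((n : ℝ) + 1)) • y n) atTop (𝓝 ((1 + 0 : ℝ) • z)) :=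
    ((tendsto_const_nhds (x := (1 : ℝ))).add tendsto_one_div_add_atTop_nhds_zero_nat).smul hz
  rw [add_zero, one_smul] at h1
  exact h1.congr fun n => (hy n).symm

/-! ### Schur's test -/

/-- The Cauchy–Schwarz inequality with a weight. -/
theorem sq_lintegral_le {β : Type*} [MeasurableSpace β] {μ : Measure β}
    {f p : β → ENNReal} (hf : AEMeasurable f μ) (hp : AEMeasurable p μ)
    (hp0 : ∀ᵐ s ∂μ, p s ≠ 0 ∧ p s ≠ ⊤) :
    (∫⁻ s, f s ∂μ) ^ 2 ≤ (∫⁻ s, p s ∂μ) * ∫⁻ s, f s ^ 2 / p s ∂μ := by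
  have h1 : ∫⁻ s, f s ∂μ
      = ∫⁻ s, ((fun s => p s ^ (1 / 2 : ℝ)) * fun s => f s * p s ^ (-(1 / 2) : ℝ)) s ∂μ := by
    refine lintegral_congr_ae (hp0.mono fun s hs => ?_)
    simp only [Pi.mul_apply]
    rw [mul_left_comm, ← ENNReal.rpow_add _ _ hs.1 hs.2]
    simp
  have h2 := ENNReal.lintegral_mul_le_Lp_mul_Lq μ Real.HolderConjugate.two_two
    (hp.pow_const (1 / 2 : ℝ)) (hf.mul (hp.pow_const (-(1 / 2) : ℝ)))
  have h3 : ∀ s, (p s ^ (1 / 2 : ℝ)) ^ (2 : ℝ) = p s := fun s => by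
    rw [← ENNReal.rpow_mul]; norm_num
  have h4 : ∀ s, (f s * p s ^ (-(1 / 2) : ℝ)) ^ (2 : ℝ) = f s ^ 2 / p s := fun s => by
    rw [ENNReal.mul_rpow_of_nonneg _ _ (by norm_num), ← ENNReal.rpow_mul, ENNReal.rpow_two,
      show (-(1 / 2) : ℝ) * 2 = -1 by norm_num, ENNReal.rpow_neg_one, div_eq_mul_inv]
  simp only [Pi.mul_apply, h3, h4] at h2
  rw [h1]
  calc _ ≤ ((∫⁻ s, p s ∂μ) ^ (1 / 2 : ℝ) * (∫⁻ s, f s ^ 2 / p s ∂μ) ^ (1 / 2 : ℝ)) ^ 2 := by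
        gcongr; exact h2
    _ = _ := by
      rw [mul_pow, ← ENNReal.rpow_two, ← ENNReal.rpow_two, ← ENNReal.rpow_mul,
        ← ENNReal.rpow_mul]
      norm_num

/-- Schur's test for the kernel that is the indicator of a set `R`. -/
theorem lintegral_mul_sq_setLIntegral_le {α β : Type*} [MeasurableSpace α] [MeasurableSpace β]
    {ν : Measure α} {μ : Measure β} [SFinite ν] [SFinite μ] {R : Set (α × β)}
    (hR : MeasurableSet R) {w P : α → ENNReal} {f p : β → ENNReal} (hw : AEMeasurable w ν)
    (hPm : AEMeasurable P ν) (hf : AEMeasurable f μ) (hp : AEMeasurable p μ)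
    (hp0 : ∀ᵐ s ∂μ, p s ≠ 0 ∧ p s ≠ ⊤)
    (hP : ∀ᵐ t ∂ν, ∫⁻ s in {s | (t, s) ∈ R}, p s ∂μ ≤ P t) (κ : ENNReal)
    (hκ : ∀ᵐ s ∂μ, ∫⁻ t in {t | (t, s) ∈ R}, w t * P t ∂ν ≤ κ * p s) :
    ∫⁻ t, w t * (∫⁻ s in {s | (t, s) ∈ R}, f s ∂μ) ^ 2 ∂ν ≤ κ * ∫⁻ s, f s ^ 2 ∂μ := by
  have hR1 : ∀ t, MeasurableSet {s | (t, s) ∈ R} := fun t => measurable_prodMk_left hR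
  have hR2 : ∀ s, MeasurableSet {t | (t, s) ∈ R} := fun s => measurable_prodMk_right hR
  have hwP : AEMeasurable (fun t => w t * P t) ν := hw.mul hPm
  have hq : AEMeasurable (fun s => f s ^ 2 / p s) μ := (hf.pow_const 2).div hp
  -- Weighted Cauchy–Schwarz on each slice, with one factor bounded by `P t`; then Tonelli, and `hκ`
  -- cancels the division by `p s`.
  calc ∫⁻ t, w t * (∫⁻ s in {s | (t, s) ∈ R}, f s ∂μ) ^ 2 ∂ν
      ≤ ∫⁻ t, w t * P t * ∫⁻ s in {s | (t, s) ∈ R}, f s ^ 2 / p s ∂μ ∂ν := by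
        refine lintegral_mono_ae (hP.mono fun t ht => ?_)
        rw [mul_assoc]
        gcongr
        refine (sq_lintegral_le hf.restrict hp.restrict (ae_restrict_of_ae hp0)).trans ?_
        gcongr
    _ = ∫⁻ t, ∫⁻ s, R.indicator (fun q => w q.1 * P q.1 * (f q.2 ^ 2 / p q.2)) (t, s) ∂μ ∂ν := by
        refine lintegral_congr fun t => ?_
        rw [← lintegral_indicator (hR1 t), ← lintegral_const_mul'' _
          (hq.indicator (hR1 t))]
        refine lintegral_congr fun s => ?_
        by_cases h : (t, s) ∈ R <;> simp [indicator, h]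
    _ = ∫⁻ s, ∫⁻ t, R.indicator (fun q => w q.1 * P q.1 * (f q.2 ^ 2 / p q.2)) (t, s) ∂ν ∂μ := by
        refine lintegral_lintegral_swap ?_
        exact (((hwP.comp_fst).mul (hq.comp_snd)).indicator hR)
    _ = ∫⁻ s, (f s ^ 2 / p s) * ∫⁻ t in {t | (t, s) ∈ R}, w t * P t ∂ν ∂μ := by
        refine lintegral_congr fun s => ?_
        rw [← lintegral_indicator (hR2 s), ← lintegral_const_mul'' _
          (hwP.indicator (hR2 s))]
        refine lintegral_congr fun t => ?_
        by_cases h : (t, s) ∈ R <;> simp [indicator, h, mul_comm]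
    _ ≤ ∫⁻ s, κ * f s ^ 2 ∂μ := by
        refine lintegral_mono_ae ?_
        filter_upwards [hκ, hp0] with s hs hs0
        calc _ ≤ f s ^ 2 / p s * (κ * p s) := by gcongr
          _ = κ * (f s ^ 2 / p s * p s) := by ring
          _ = _ := by rw [ENNReal.div_mul_cancel hs0.1 hs0.2]
    _ = _ := lintegral_const_mul'' _ (hf.pow_const 2)

/-! ### Hardy's inequality -/

theorem setLIntegral_ofReal_eq {f : ℝ → ℝ} {a b : ℝ} (hab : a ≤ b)
    (hf : IntervalIntegrable f volume a b) (h0 : ∀ t ∈ Ioc a b, 0 ≤ f t) :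
    ∫⁻ t in Icc a b, ENNReal.ofReal (f t) = ENNReal.ofReal (∫ t in a..b, f t) := by
  rw [intervalIntegral.integral_of_le hab, ofReal_integral_eq_lintegral_ofReal
    ((intervalIntegrable_iff_integrableOn_Ioc_of_le hab).1 hf)
    ((ae_restrict_iff' measurableSet_Ioc).2 (.of_forall h0)), restrict_Ioc_eq_restrict_Icc]

theorem ae_mem_Ioo : ∀ᵐ t ∂(volume.restrict I), t ∈ Ioo (0 : ℝ) 1 := by
  rw [show volume.restrict I = volume.restrict (Ioo (0 : ℝ) 1) from
    (Measure.restrict_congr_set Ioo_ae_eq_Icc).symm]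
  exact ae_restrict_mem measurableSet_Ioo

/-- Integrability is known only away from 0, so `(0,1]` is exhausted by the intervals `[1/(n+1),
1]`. -/
theorem MemZ.aemeasurable {ℓ : ℝ} {h : ℝ → ℝ} (hh : MemZ ℓ h) :
    AEMeasurable h (volume.restrict I) := by
  rw [show volume.restrict I = volume.restrict (Ioc (0 : ℝ) 1) from
    (Measure.restrict_congr_set Ioc_ae_eq_Icc).symm]
  have : Ioc (0 : ℝ) 1 ⊆ ⋃ n : ℕ, Icc (1 / ((n : ℝ) + 1)) 1 := by
    intro t ht
    obtain ⟨n, hn⟩ := exists_nat_one_div_lt ht.1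
    exact mem_iUnion.2 ⟨n, hn.le, ht.2⟩
  refine AEMeasurable.mono_set this ((aemeasurable_iUnion_iff (μ := volume)).2 fun n => ?_)
  refine (hh.integrableOn _ _ (Icc_subset_Ioc ?_ le_rfl)).aemeasurable
  positivity

theorem MemZ.setLIntegral_le {ℓ : ℝ} {h : ℝ → ℝ} (hh : MemZ ℓ h) {t : ℝ}
    (ht : t ∈ Ioo (0 : ℝ) 1) :
    ∫⁻ s in Icc t 1, ENNReal.ofReal (h s) ≤ ENNReal.ofReal (ℓ / t) := by
  have hi := hh.integrableOn t 1 (Icc_subset_Ioc ht.1 le_rfl)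
  rw [setLIntegral_ofReal_eq ht.2.le
    ((intervalIntegrable_iff_integrableOn_Icc_of_le ht.2.le).2 hi)
    fun s hs => hh.nonneg s ⟨ht.1.le.trans hs.1.le, hs.2⟩]
  exact ENNReal.ofReal_le_ofReal (hh.integral_le t ht)

theorem setLIntegral_rpow_neg_half {t : ℝ} (ht : 0 ≤ t) :
    ∫⁻ s in Icc 0 t, ENNReal.ofReal (s ^ (-(1 / 2) : ℝ)) = ENNReal.ofReal (2 * t ^ (1 / 2 : ℝ)) := by
  rw [setLIntegral_ofReal_eq ht (intervalIntegral.intervalIntegrable_rpow' (by norm_num))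
    fun s hs => Real.rpow_nonneg hs.1.le _, integral_rpow (Or.inl (by norm_num))]
  congr 1
  norm_num
  ring

theorem setLIntegral_rpow_neg_three_halves_le {s : ℝ} (hs : s ∈ Ioo (0 : ℝ) 1) :
    ∫⁻ r in Icc s 1, ENNReal.ofReal (r ^ (-(3 / 2) : ℝ))
      ≤ ENNReal.ofReal (2 * s ^ (-(1 / 2) : ℝ)) := by
  have h0 : (0 : ℝ) ∉ uIcc s 1 := by
    rw [uIcc_of_le hs.2.le]
    exact fun h => absurd h.1 (not_le.2 hs.1)
  rw [setLIntegral_ofReal_eq hs.2.le (intervalIntegral.intervalIntegrable_rpow (Or.inr h0))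
    fun r hr => Real.rpow_nonneg (hs.1.le.trans hr.1.le) _,
    integral_rpow (Or.inr ⟨by norm_num, h0⟩)]
  apply ENNReal.ofReal_le_ofReal
  norm_num
  linarith

/-- Hardy's inequality for a weight in `𝒵(ℓ)`. -/
theorem MemZ.hardy {ℓ : ℝ} {h : ℝ → ℝ} (hh : MemZ ℓ h) (hl : 0 ≤ ℓ) {f : ℝ → ENNReal}
    (hf : AEMeasurable f (volume.restrict I)) :
    ∫⁻ t in I, ENNReal.ofReal (h t) * (∫⁻ s in Icc 0 t, f s ∂(volume.restrict I)) ^ 2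
      ≤ ENNReal.ofReal (4 * ℓ) * ∫⁻ s in I, f s ^ 2 := by
  set R : Set (ℝ × ℝ) := {q | 0 ≤ q.2 ∧ q.2 ≤ q.1} with hRdef
  have hR : MeasurableSet R :=
    (measurableSet_le measurable_const measurable_snd).inter
      (measurableSet_le measurable_snd measurable_fst)
  have hpm : Measurable fun s : ℝ => ENNReal.ofReal (s ^ (-(1 / 2) : ℝ)) := by fun_prop
  -- The test weight `s^(-1/2)` has primitive `2 t^(1/2)`.
  refine lintegral_mul_sq_setLIntegral_le (ν := volume.restrict I) (μ := volume.restrict I) hR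
    (P := fun t => ENNReal.ofReal (2 * t ^ (1 / 2 : ℝ)))
    (p := fun s => ENNReal.ofReal (s ^ (-(1 / 2) : ℝ)))
    hh.aemeasurable.ennreal_ofReal (by fun_prop) hf hpm.aemeasurable ?_ ?_ _ ?_
  · filter_upwards [ae_mem_Ioo] with s hs
    exact ⟨(ENNReal.ofReal_pos.2 (Real.rpow_pos_of_pos hs.1 _)).ne', ENNReal.ofReal_ne_top⟩
  · filter_upwards [ae_mem_Ioo] with t ht
    refine (lintegral_mono' (Measure.restrict_mono_measure Measure.restrict_le_self _)
      le_rfl).trans ?_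
    exact (setLIntegral_rpow_neg_half ht.1.le).le
  · filter_upwards [ae_mem_Ioo] with s hs
    have hset : {t | (t, s) ∈ R} = Ici s := by
      ext t
      simp [hRdef, hs.1.le]
    rw [hset]
    -- Only tail integrals of `h` are controlled. Hence `2 t^(1/2)` is written back as `∫₀ᵗ r^(-1/2)
    -- dr` and the order exchanged, leaving the tail from `max r s`. The ranges `r ≤ s` and `r ≥ s`
    -- each contribute at most `2ℓ s^(-1/2)`.
    calc ∫⁻ t in Ici s, ENNReal.ofReal (h t) * ENNReal.ofReal (2 * t ^ (1 / 2 : ℝ))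
            ∂(volume.restrict I)
        = ∫⁻ t in Ici s, ∫⁻ r, R.indicator (fun q => ENNReal.ofReal (h q.1) *
            ENNReal.ofReal (q.2 ^ (-(1 / 2) : ℝ))) (t, r) ∂(volume.restrict I)
            ∂(volume.restrict I) := by
          refine lintegral_congr_ae (ae_restrict_of_ae ?_)
          filter_upwards [ae_mem_Ioo] with t ht
          show _ = ∫⁻ r, (Icc 0 t).indicator (fun r => ENNReal.ofReal (h t) *
            ENNReal.ofReal (r ^ (-(1 / 2) : ℝ))) r ∂(volume.restrict I)
          rw [lintegral_indicator measurableSet_Icc, lintegral_const_mul _ hpm,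
            Measure.restrict_restrict measurableSet_Icc,
            inter_eq_left.2 (Icc_subset_Icc le_rfl ht.2.le), setLIntegral_rpow_neg_half ht.1.le]
      _ = ∫⁻ r, ∫⁻ t in Ici s, R.indicator (fun q => ENNReal.ofReal (h q.1) *
            ENNReal.ofReal (q.2 ^ (-(1 / 2) : ℝ))) (t, r) ∂(volume.restrict I)
            ∂(volume.restrict I) := by
          refine lintegral_lintegral_swap ?_
          exact (((hh.aemeasurable.ennreal_ofReal.restrict).comp_fst).mul
            (hpm.aemeasurable.comp_snd)).indicator hR
      _ ≤ ∫⁻ r in I, ENNReal.ofReal (r ^ (-(1 / 2) : ℝ)) * ENNReal.ofReal (ℓ / max r s) := by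
          refine lintegral_mono_ae ?_
          filter_upwards [ae_mem_Ioo] with r hr
          have : ∀ t, R.indicator (fun q => ENNReal.ofReal (h q.1) *
            ENNReal.ofReal (q.2 ^ (-(1 / 2) : ℝ))) (t, r) = (Ici r).indicator
              (fun t => ENNReal.ofReal (r ^ (-(1 / 2) : ℝ)) * ENNReal.ofReal (h t)) t := by
            intro t
            by_cases h : r ≤ t <;> simp [hRdef, indicator, h, hr.1.le, mul_comm]
          simp only [this]
          rw [lintegral_indicator measurableSet_Ici, lintegral_const_mul'' _
            hh.aemeasurable.ennreal_ofReal.restrict.restrict,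
            Measure.restrict_restrict measurableSet_Ici,
            Measure.restrict_restrict (measurableSet_Ici.inter measurableSet_Ici)]
          gcongr
          rw [Ici_inter_Ici]
          refine (lintegral_mono_set ?_).trans
            (hh.setLIntegral_le (t := max r s) ⟨lt_max_of_lt_left hr.1, max_lt hr.2 hs.2⟩)
          exact fun t ht => ⟨ht.1, ht.2.2⟩
      _ ≤ (∫⁻ r in Icc 0 s, ENNReal.ofReal (ℓ / s) * ENNReal.ofReal (r ^ (-(1 / 2) : ℝ)))
          + ∫⁻ r in Icc s 1, ENNReal.ofReal ℓ * ENNReal.ofReal (r ^ (-(3 / 2) : ℝ)) := by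
          rw [I, ← Icc_union_Icc_eq_Icc hs.1.le hs.2.le]
          refine (lintegral_union_le _ _ _).trans (add_le_add ?_ ?_)
          · refine setLIntegral_mono' measurableSet_Icc fun r hr => ?_
            rw [max_eq_right hr.2, mul_comm]
          · refine setLIntegral_mono' measurableSet_Icc fun r hr => ?_
            have hr0 : 0 < r := hs.1.trans_le hr.1
            rw [max_eq_left hr.1, ← ENNReal.ofReal_mul (by positivity), ← ENNReal.ofReal_mul hl]
            refine (congrArg ENNReal.ofReal ?_).le
            rw [show (-(3 / 2) : ℝ) = -(1 / 2) - 1 by norm_num, Real.rpow_sub_one hr0.ne']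
            ring
      _ ≤ ENNReal.ofReal (ℓ / s) * ENNReal.ofReal (2 * s ^ (1 / 2 : ℝ))
          + ENNReal.ofReal ℓ * ENNReal.ofReal (2 * s ^ (-(1 / 2) : ℝ)) := by
          rw [lintegral_const_mul _ hpm, lintegral_const_mul _ (by fun_prop),
            setLIntegral_rpow_neg_half hs.1.le]
          gcongr
          exact setLIntegral_rpow_neg_three_halves_le hs
      _ = ENNReal.ofReal (4 * ℓ) * ENNReal.ofReal (s ^ (-(1 / 2) : ℝ)) := by
          have hs0 := hs.1
          rw [← ENNReal.ofReal_mul (by positivity), ← ENNReal.ofReal_mul hl,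
            ← ENNReal.ofReal_mul (by positivity),
            ← ENNReal.ofReal_add (by positivity) (by positivity)]
          congr 1
          rw [show (-(1 / 2) : ℝ) = 1 / 2 - 1 by norm_num, Real.rpow_sub_one hs0.ne']
          field_simp
          ring

/-! ### Wirtinger's inequality -/

/-- Wirtinger's inequality for primitives that vanish at a point `ξ` of `[0,1]`. -/
theorem wirtinger {ξ : ℝ} (hξ : ξ ∈ I) {f : ℝ → ENNReal}
    (hf : AEMeasurable f (volume.restrict I)) :
    ∫⁻ t in I, (∫⁻ s in uIcc ξ t, f s ∂(volume.restrict I)) ^ 2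
      ≤ ENNReal.ofReal ((2 / Real.pi) ^ 2) * ∫⁻ s in I, f s ^ 2 := by
  have hpi := Real.pi_pos
  set R : Set (ℝ × ℝ) := {q | min ξ q.1 ≤ q.2 ∧ q.2 ≤ max ξ q.1} with hRdef
  have hR : MeasurableSet R :=
    (measurableSet_le (by fun_prop) measurable_snd).inter
      (measurableSet_le measurable_snd (by fun_prop))
  have hR2 : ∀ s, MeasurableSet {t | (t, s) ∈ R} := fun s => measurable_prodMk_right hR
  have hcos : ∀ s ∈ Ioo (0 : ℝ) 1, 0 < Real.cos (Real.pi / 2 * (s - ξ)) := fun s hs =>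
    Real.cos_pos_of_mem_Ioo ⟨by nlinarith [hs.1, hξ.2], by nlinarith [hs.2, hξ.1]⟩
  have hcos' : ∀ s ∈ I, 0 ≤ Real.cos (Real.pi / 2 * (s - ξ)) := fun s hs =>
    Real.cos_nonneg_of_mem_Icc ⟨by nlinarith [hs.1, hξ.2], by nlinarith [hs.2, hξ.1]⟩
  have hint : ∀ a b, ∫ s in a..b, Real.cos (Real.pi / 2 * (s - ξ))
      = 2 / Real.pi * (Real.sin (Real.pi / 2 * (b - ξ)) - Real.sin (Real.pi / 2 * (a - ξ))) := by
    intro a b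
    rw [intervalIntegral.integral_eq_sub_of_hasDerivAt
      (f := fun s => 2 / Real.pi * Real.sin (Real.pi / 2 * (s - ξ)))]
    · ring
    · intro s _
      have := (((hasDerivAt_id s).sub_const ξ).const_mul (Real.pi / 2)).sin.const_mul (2 / Real.pi)
      refine this.congr_deriv ?_
      simp only [id]
      field_simp
    · exact Continuous.intervalIntegrable (by fun_prop) _ _
  have hint' : ∀ a b, ∫ s in a..b, Real.sin (Real.pi / 2 * (s - ξ))
      = 2 / Real.pi * (Real.cos (Real.pi / 2 * (a - ξ)) - Real.cos (Real.pi / 2 * (b - ξ))) := by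
    intro a b
    rw [intervalIntegral.integral_eq_sub_of_hasDerivAt
      (f := fun s => -(2 / Real.pi * Real.cos (Real.pi / 2 * (s - ξ))))]
    · ring
    · intro s _
      have := ((((hasDerivAt_id s).sub_const ξ).const_mul (Real.pi / 2)).cos.const_mul
        (2 / Real.pi)).neg
      refine this.congr_deriv ?_
      simp only [id]
      field_simp
    · exact Continuous.intervalIntegrable (by fun_prop) _ _
  have hsin : ∀ t ∈ I, ξ ≤ t → 0 ≤ Real.sin (Real.pi / 2 * (t - ξ)) := fun t ht h =>
    Real.sin_nonneg_of_nonneg_of_le_pi (by nlinarith) (by nlinarith [hξ.1, ht.2])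
  have hsin' : ∀ t ∈ I, t ≤ ξ → Real.sin (Real.pi / 2 * (t - ξ)) ≤ 0 := fun t ht h =>
    Real.sin_nonpos_of_nonpos_of_neg_pi_le (by nlinarith) (by nlinarith [hξ.2, ht.1])
  -- The test weight is the derivative, up to a factor, of the extremal `sin (π/2 (t - ξ))`; it is
  -- positive because `|s - ξ| < 1`.
  have hmain := lintegral_mul_sq_setLIntegral_le (ν := volume.restrict I)
    (μ := volume.restrict I) hR (w := fun _ => 1)
    (P := fun t => ENNReal.ofReal (2 / Real.pi * |Real.sin (Real.pi / 2 * (t - ξ))|))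
    (p := fun s => ENNReal.ofReal (Real.cos (Real.pi / 2 * (s - ξ)))) (by fun_prop)
    (by fun_prop) hf (by fun_prop) ?_ ?_ (ENNReal.ofReal ((2 / Real.pi) ^ 2)) ?_
  · simp only [one_mul] at hmain
    exact hmain
  · filter_upwards [ae_mem_Ioo] with s hs
    exact ⟨(ENNReal.ofReal_pos.2 (hcos s hs)).ne', ENNReal.ofReal_ne_top⟩
  · filter_upwards [ae_mem_Ioo] with t ht
    have htI := Ioo_subset_Icc_self ht
    refine (lintegral_mono' (Measure.restrict_mono_measure Measure.restrict_le_self _)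
      le_rfl).trans ?_
    show ∫⁻ s in Icc (min ξ t) (max ξ t), _ ≤ _
    rw [setLIntegral_ofReal_eq min_le_max
      (Continuous.intervalIntegrable (by fun_prop) _ _) fun s hs => hcos' s
        ⟨(le_min hξ.1 htI.1).trans hs.1.le, hs.2.trans (max_le hξ.2 htI.2)⟩, hint]
    apply ENNReal.ofReal_le_ofReal
    rcases le_total ξ t with h | h
    · rw [min_eq_left h, max_eq_right h]
      simp [abs_of_nonneg (hsin t htI h)]
    · rw [min_eq_right h, max_eq_left h]
      simp [abs_of_nonpos (hsin' t htI h)]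
  -- The slice over `s` is `[0,s]` or `[s,1]` according to the side of `ξ`; at `s = ξ` it would be
  -- all of `[0,1]`. The endpoint cosine has a favourable sign and is dropped (`hend`).
  · filter_upwards [ae_mem_Ioo, compl_mem_ae_iff.2 (measure_singleton ξ)] with s hs hne
    simp only [one_mul]
    rw [← ENNReal.ofReal_mul (by positivity)]
    have hend : ∀ b ∈ I, 0 ≤ (2 / Real.pi) ^ 2 * Real.cos (Real.pi / 2 * (b - ξ)) := fun b hb =>
      mul_nonneg (by positivity) (hcos' b hb)
    rcases lt_or_gt_of_ne hne with h | h
    · rw [Measure.restrict_restrict (hR2 s)]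
      refine (lintegral_mono_set (t := Icc 0 s) ?_).trans ?_
      · rintro t ⟨ht, htI⟩
        exact ⟨htI.1, (min_le_iff.1 ht.1).resolve_left (not_le.2 h)⟩
      rw [setLIntegral_ofReal_eq hs.1.le
        (Continuous.intervalIntegrable (by fun_prop) _ _) fun t _ => by positivity]
      apply ENNReal.ofReal_le_ofReal
      have : EqOn (fun t => 2 / Real.pi * |Real.sin (Real.pi / 2 * (t - ξ))|)
          (fun t => -(2 / Real.pi) * Real.sin (Real.pi / 2 * (t - ξ))) (uIcc 0 s) := by
        intro t ht
        rw [uIcc_of_le hs.1.le] at ht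
        simp only
        rw [abs_of_nonpos (hsin' t ⟨ht.1, ht.2.trans hs.2.le⟩ (ht.2.trans h.le))]
        ring
      rw [intervalIntegral.integral_congr this, intervalIntegral.integral_const_mul, hint']
      nlinarith [hend 0 (by simp)]
    · rw [Measure.restrict_restrict (hR2 s)]
      refine (lintegral_mono_set (t := Icc s 1) ?_).trans ?_
      · rintro t ⟨ht, htI⟩
        exact ⟨(le_max_iff.1 ht.2).resolve_left (not_le.2 h), htI.2⟩
      rw [setLIntegral_ofReal_eq hs.2.le
        (Continuous.intervalIntegrable (by fun_prop) _ _) fun t _ => by positivity]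
      apply ENNReal.ofReal_le_ofReal
      have : EqOn (fun t => 2 / Real.pi * |Real.sin (Real.pi / 2 * (t - ξ))|)
          (fun t => (2 / Real.pi) * Real.sin (Real.pi / 2 * (t - ξ))) (uIcc s 1) := by
        intro t ht
        rw [uIcc_of_le hs.2.le] at ht
        simp only
        rw [abs_of_nonneg (hsin t ⟨hs.1.le.trans ht.1, ht.2⟩ (h.le.trans ht.1))]
      rw [intervalIntegral.integral_congr this, intervalIntegral.integral_const_mul, hint']
      nlinarith [hend 1 (by simp)]

/-! ### The linear problem -/

theorem MemL2.intervalIntegrable {y : ℝ → ℝ} (hy : MemL2 y) {a b : ℝ} (ha : a ∈ I) (hb : b ∈ I) :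
    IntervalIntegrable y volume a b := by
  have h : IntegrableOn y I := MemLp.integrable one_le_two hy
  exact (h.mono_set (uIcc_subset_Icc ha hb)).intervalIntegrable

theorem MemL2.intervalIntegrable_sq {y : ℝ → ℝ} (hy : MemL2 y) {a b : ℝ} (ha : a ∈ I)
    (hb : b ∈ I) : IntervalIntegrable (fun s => y s ^ 2) volume a b := by
  have h : IntegrableOn (fun s => y s ^ 2) I := hy.integrable_sq
  exact (h.mono_set (uIcc_subset_Icc ha hb)).intervalIntegrable

/-- The derivative of the solution of `x'' = y`, `x 0 = 0`, `x' 1 = δ * x' η`. -/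
noncomputable def V (δ η : ℝ) (y : ℝ → ℝ) (t : ℝ) : ℝ :=
  (δ * (∫ s in (0 : ℝ)..η, y s) - ∫ s in (0 : ℝ)..1, y s) / (1 - δ) + ∫ s in (0 : ℝ)..t, y s

/-- The solution of `x'' = y`, `x 0 = 0`, `x' 1 = δ * x' η`. -/
noncomputable def X (δ η : ℝ) (y : ℝ → ℝ) (t : ℝ) : ℝ := ∫ s in (0 : ℝ)..t, V δ η y s

theorem zero_mem_I : (0 : ℝ) ∈ I := ⟨le_rfl, zero_le_one⟩

theorem one_mem_I : (1 : ℝ) ∈ I := ⟨zero_le_one, le_rfl⟩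

variable {δ η : ℝ} {y z : ℝ → ℝ}

theorem V_absolutelyContinuous (δ η : ℝ) (hy : MemL2 y) :
    AbsolutelyContinuousOnInterval (V δ η y) 0 1 :=
  AbsolutelyContinuousOnInterval.add
    (f := fun _ => (δ * (∫ s in (0 : ℝ)..η, y s) - ∫ s in (0 : ℝ)..1, y s) / (1 - δ))
    (LipschitzOnWith.absolutelyContinuousOnInterval
      (LipschitzWith.const _).lipschitzOnWith)
    ((hy.intervalIntegrable zero_mem_I one_mem_I).absolutelyContinuousOnInterval_intervalIntegral
      left_mem_uIcc)

theorem V_continuousOn (δ η : ℝ) (hy : MemL2 y) : ContinuousOn (V δ η y) I := by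
  have := (V_absolutelyContinuous δ η hy).continuousOn
  rwa [uIcc_of_le zero_le_one] at this

theorem V_intervalIntegrable (δ η : ℝ) (hy : MemL2 y) {a b : ℝ} (ha : a ∈ I) (hb : b ∈ I) :
    IntervalIntegrable (V δ η y) volume a b :=
  ((V_continuousOn δ η hy).mono (uIcc_subset_Icc ha hb)).intervalIntegrable

theorem X_hasDerivWithinAt (δ η : ℝ) (hy : MemL2 y) {t : ℝ} (ht : t ∈ I) :
    HasDerivWithinAt (X δ η y) (V δ η y t) I t := by
  -- Instance needed for the fundamental theorem of calculus within `[0,1]`, one-sided at the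
  -- endpoints.
  have : Fact (t ∈ Icc (0 : ℝ) 1) := ⟨ht⟩
  exact intervalIntegral.integral_hasDerivWithinAt_right
    (V_intervalIntegrable δ η hy zero_mem_I ht)
    ((V_continuousOn δ η hy).stronglyMeasurableAtFilter_nhdsWithin measurableSet_Icc t)
    (V_continuousOn δ η hy t ht)

theorem X_continuousOn (δ η : ℝ) (hy : MemL2 y) : ContinuousOn (X δ η y) I :=
  fun _ ht => (X_hasDerivWithinAt δ η hy ht).continuousWithinAt

theorem V_sub_eq (δ η : ℝ) (hy : MemL2 y) {a t : ℝ} (ha : a ∈ I) (ht : t ∈ I) :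
    V δ η y t - V δ η y a = ∫ s in a..t, y s := by
  simp only [V]
  rw [add_sub_add_left_eq_sub, intervalIntegral.integral_interval_sub_left
    (hy.intervalIntegrable zero_mem_I ht) (hy.intervalIntegrable zero_mem_I ha)]

theorem V_one (hδ : δ ≠ 1) : V δ η y 1 = δ * V δ η y η := by
  have : 1 - δ ≠ 0 := sub_ne_zero.2 hδ.symm
  simp only [V]
  field_simp
  ring

theorem V_sub (δ : ℝ) (hη : η ∈ I) (hy : MemL2 y) (hz : MemL2 z) {t : ℝ} (ht : t ∈ I) :
    V δ η (fun s => y s - z s) t = V δ η y t - V δ η z t := by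
  have h : ∀ b ∈ I, ∫ s in (0 : ℝ)..b, (y s - z s)
      = (∫ s in (0 : ℝ)..b, y s) - ∫ s in (0 : ℝ)..b, z s := fun b hb =>
    intervalIntegral.integral_sub (hy.intervalIntegrable zero_mem_I hb)
      (hz.intervalIntegrable zero_mem_I hb)
  simp only [V]
  rw [h _ hη, h _ ht, h _ one_mem_I]
  ring

theorem X_sub (δ : ℝ) (hη : η ∈ I) (hy : MemL2 y) (hz : MemL2 z) {t : ℝ} (ht : t ∈ I) :
    X δ η (fun s => y s - z s) t = X δ η y t - X δ η z t := by
  simp only [X]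
  rw [← intervalIntegral.integral_sub (V_intervalIntegrable δ η hy zero_mem_I ht)
    (V_intervalIntegrable δ η hz zero_mem_I ht)]
  exact intervalIntegral.integral_congr fun s hs =>
    V_sub δ hη hy hz (uIcc_subset_Icc zero_mem_I ht hs)

/-! ### Bounds for `X` and `V` -/

theorem enorm_intervalIntegral_le (f : ℝ → ℝ) {a b : ℝ} (ha : a ∈ I) (hb : b ∈ I) :
    ‖∫ s in a..b, f s‖ₑ ≤ ∫⁻ s in uIcc a b, ‖f s‖ₑ ∂(volume.restrict I) := by
  rw [Measure.restrict_restrict measurableSet_uIcc, inter_eq_left.2 (uIcc_subset_Icc ha hb)]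
  have : ‖∫ s in a..b, f s‖ₑ = ‖∫ s in uIoc a b, f s‖ₑ := by
    rw [← ofReal_norm, ← ofReal_norm, intervalIntegral.norm_intervalIntegral_eq]
  rw [this]
  exact (enorm_integral_le_lintegral_enorm _).trans (lintegral_mono_set uIoc_subset_uIcc)

theorem lintegral_mul_sq_X_le {ℓ : ℝ} {h : ℝ → ℝ} (hh : MemZ ℓ h) (hl : 0 ≤ ℓ) (δ η : ℝ)
    (hy : MemL2 y) :
    ∫⁻ t in I, ENNReal.ofReal (h t) * ‖X δ η y t‖ₑ ^ 2
      ≤ ENNReal.ofReal (4 * ℓ) * ∫⁻ t in I, ‖V δ η y t‖ₑ ^ 2 := by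
  refine le_trans (setLIntegral_mono' measurableSet_Icc fun t ht => ?_) (hh.hardy hl
    ((V_continuousOn δ η hy).aestronglyMeasurable measurableSet_Icc).enorm)
  gcongr
  have := enorm_intervalIntegral_le (V δ η y) zero_mem_I ht
  rwa [uIcc_of_le ht.1] at this

theorem lintegral_sq_V_le_of_eq_zero {ξ : ℝ} (hξ : ξ ∈ I) (hy : MemL2 y)
    (h0 : V δ η y ξ = 0) :
    ∫⁻ t in I, ‖V δ η y t‖ₑ ^ 2
      ≤ ENNReal.ofReal ((2 / Real.pi) ^ 2) * ∫⁻ t in I, ‖y t‖ₑ ^ 2 := by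
  refine le_trans (setLIntegral_mono' measurableSet_Icc fun t ht => ?_)
    (wirtinger hξ hy.aestronglyMeasurable.enorm)
  gcongr
  rw [← sub_zero (V δ η y t), ← h0, V_sub_eq δ η hy hξ ht]
  exact enorm_intervalIntegral_le y hξ ht

/-- For `δ ≤ 0` the values at `η` and at 1 do not have the same strict sign, so the intermediate
value theorem applies. -/
theorem exists_V_eq_zero (hδ : δ ≤ 0) (hη : η ∈ I) (hy : MemL2 y) :
    ∃ ξ ∈ I, V δ η y ξ = 0 := by
  have h1 := V_one (y := y) (η := η) (show δ ≠ 1 by linarith)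
  have hsub : uIcc η 1 ⊆ I := uIcc_subset_Icc hη one_mem_I
  have hz : (0 : ℝ) ∈ uIcc (V δ η y η) (V δ η y 1) := by
    rw [h1, mem_uIcc]
    rcases le_total 0 (V δ η y η) with h | h
    · exact Or.inr ⟨mul_nonpos_of_nonpos_of_nonneg hδ h, h⟩
    · exact Or.inl ⟨h, mul_nonneg_of_nonpos_of_nonpos hδ h⟩
  obtain ⟨ξ, hξ, h⟩ := intermediate_value_uIcc ((V_continuousOn δ η hy).mono hsub) hz
  exact ⟨ξ, hsub hξ, h⟩

/-- Integrate `(y - m)² ≥ 0` with `m` the mean of `y` on `[a,b]`. -/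
theorem sq_intervalIntegral_le (hy : MemL2 y) {a b : ℝ} (ha : a ∈ I) (hb : b ∈ I) (hab : a ≤ b) :
    (∫ s in a..b, y s) ^ 2 ≤ (b - a) * ∫ s in a..b, y s ^ 2 := by
  rcases hab.eq_or_lt with rfl | h
  · simp
  have hL : 0 < b - a := sub_pos.2 h
  have hi := hy.intervalIntegrable ha hb
  have hi2 := hy.intervalIntegrable_sq ha hb
  set A := ∫ s in a..b, y s
  set m := A / (b - a)
  have h0 : 0 ≤ ∫ s in a..b, ((y s ^ 2 - 2 * m * y s) + m ^ 2) :=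
    intervalIntegral.integral_nonneg hab fun s _ => by
      nlinarith [sq_nonneg (y s - m)]
  rw [intervalIntegral.integral_add (hi2.sub (hi.const_mul _)) (by simp),
    intervalIntegral.integral_sub hi2 (hi.const_mul _), intervalIntegral.integral_const_mul,
    intervalIntegral.integral_const, smul_eq_mul] at h0
  have hm : m * (b - a) = A := div_mul_cancel₀ _ hL.ne'
  have h2 : A ^ 2 = (b - a) * (m * A) := by rw [← mul_assoc, mul_comm (b - a) m, hm, sq]
  rw [h2]
  refine mul_le_mul_of_nonneg_left ?_ hL.le
  have : (b - a) * m ^ 2 = m * A := by rw [← hm]; ring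
  rw [this] at h0
  linarith

/-- Cauchy–Schwarz against the step function equal to `p` on `[a,b]` and `q` on `[b,c]`. It serves
for the kernel of `V`, piecewise constant in `s`. -/
theorem sq_add_intervalIntegral_le (hy : MemL2 y) {a b c : ℝ} (ha : a ∈ I) (hb : b ∈ I)
    (hc : c ∈ I) (hab : a ≤ b) (hbc : b ≤ c) (p q : ℝ) :
    (p * (∫ s in a..b, y s) + q * ∫ s in b..c, y s) ^ 2
      ≤ (p ^ 2 * (b - a) + q ^ 2 * (c - b)) * ∫ s in (0 : ℝ)..1, y s ^ 2 := by
  have h1 := sq_intervalIntegral_le hy ha hb hab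
  have h2 := sq_intervalIntegral_le hy hb hc hbc
  have hY1 : 0 ≤ ∫ s in a..b, y s ^ 2 :=
    intervalIntegral.integral_nonneg hab fun s _ => sq_nonneg _
  have hY2 : 0 ≤ ∫ s in b..c, y s ^ 2 :=
    intervalIntegral.integral_nonneg hbc fun s _ => sq_nonneg _
  have hY : (∫ s in a..b, y s ^ 2) + ∫ s in b..c, y s ^ 2 ≤ ∫ s in (0 : ℝ)..1, y s ^ 2 := by
    rw [intervalIntegral.integral_add_adjacent_intervals (hy.intervalIntegrable_sq ha hb)
      (hy.intervalIntegrable_sq hb hc)]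
    exact intervalIntegral.integral_mono_interval ha.1 (hab.trans hbc) hc.2
      (.of_forall fun s => sq_nonneg _) (hy.intervalIntegrable_sq zero_mem_I one_mem_I)
  set α := ∫ s in a..b, y s
  set β := ∫ s in b..c, y s
  set Y1 := ∫ s in a..b, y s ^ 2
  set Y2 := ∫ s in b..c, y s ^ 2
  have hba := sub_nonneg.2 hab
  have hcb := sub_nonneg.2 hbc
  have hpα : (p * α) ^ 2 ≤ p ^ 2 * (b - a) * Y1 := by
    rw [mul_pow, mul_assoc]; exact mul_le_mul_of_nonneg_left h1 (sq_nonneg p)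
  have hqβ : (q * β) ^ 2 ≤ q ^ 2 * (c - b) * Y2 := by
    rw [mul_pow, mul_assoc]; exact mul_le_mul_of_nonneg_left h2 (sq_nonneg q)
  have hP : 0 ≤ p ^ 2 * (b - a) := by positivity
  have hQ : 0 ≤ q ^ 2 * (c - b) := by positivity
  set P := p ^ 2 * (b - a)
  set Q := q ^ 2 * (c - b)
  have hcross : 2 * (p * α) * (q * β) ≤ P * Y2 + Q * Y1 := by
    refine le_of_abs_le (abs_le_of_sq_le_sq' ?_ (by positivity) |> abs_le.2)
    have h3 : (p * α) ^ 2 * (q * β) ^ 2 ≤ P * Y1 * (Q * Y2) :=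
      mul_le_mul hpα hqβ (sq_nonneg _) (by positivity)
    nlinarith [sq_nonneg (P * Y2 - Q * Y1)]
  calc (p * α + q * β) ^ 2 = (p * α) ^ 2 + 2 * (p * α) * (q * β) + (q * β) ^ 2 := by ring
    _ ≤ (P + Q) * (Y1 + Y2) := by linarith
    _ ≤ _ := mul_le_mul_of_nonneg_left hY (by positivity)

theorem sq_V_le_left (hδ : δ ≠ 1) (hη : η ∈ I) (hy : MemL2 y) {t : ℝ} (ht : t ∈ Icc 0 η) :
    V δ η y t ^ 2 ≤ ((η - t) + (1 / (1 - δ)) ^ 2 * (1 - η)) * ∫ s in (0 : ℝ)..1, y s ^ 2 := by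
  have h1δ : 1 - δ ≠ 0 := sub_ne_zero.2 hδ.symm
  have htI : t ∈ I := ⟨ht.1, ht.2.trans hη.2⟩
  have h := sq_add_intervalIntegral_le hy htI hη one_mem_I ht.2 hη.2 1 (1 / (1 - δ))
  have h1 := V_sub_eq δ η hy htI hη
  have h2 := V_sub_eq δ η hy hη one_mem_I
  have h3 := V_one (y := y) (η := η) hδ
  -- The boundary condition turns `∫_η^1 y` into `(δ - 1) V(η)`.
  have : 1 * (∫ s in t..η, y s) + 1 / (1 - δ) * (∫ s in η..1, y s) = -V δ η y t := by
    rw [← h1, ← h2, h3]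
    field_simp
    ring
  rw [this, neg_sq, one_pow, one_mul] at h
  exact h

theorem sq_V_le_right (hδ : δ ≠ 1) (hη : η ∈ I) (hy : MemL2 y) {t : ℝ} (ht : t ∈ Icc η 1) :
    V δ η y t ^ 2 ≤ ((δ / (1 - δ)) ^ 2 * (t - η) + (1 / (1 - δ)) ^ 2 * (1 - t))
      * ∫ s in (0 : ℝ)..1, y s ^ 2 := by
  have h1δ : 1 - δ ≠ 0 := sub_ne_zero.2 hδ.symm
  have htI : t ∈ I := ⟨hη.1.trans ht.1, ht.2⟩
  have h := sq_add_intervalIntegral_le hy hη htI one_mem_I ht.1 ht.2 (δ / (1 - δ)) (1 / (1 - δ))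
  have h1 := V_sub_eq δ η hy hη htI
  have h2 := V_sub_eq δ η hy htI one_mem_I
  have h3 := V_one (y := y) (η := η) hδ
  have : δ / (1 - δ) * (∫ s in η..t, y s) + 1 / (1 - δ) * (∫ s in t..1, y s) = -V δ η y t := by
    rw [← h1, ← h2, h3]
    field_simp
    ring
  rw [this, neg_sq] at h
  exact h

theorem enorm_sq_eq (x : ℝ) : ‖x‖ₑ ^ 2 = ENNReal.ofReal (x ^ 2) := by
  rw [Real.enorm_eq_ofReal_abs, ← ENNReal.ofReal_pow (abs_nonneg _), sq_abs]

/-- Integrating the pointwise bounds over `[0,η]` and `[η,1]` gives the squared Hilbert–Schmidt norm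
of the kernel, which is exactly `F δ η`. -/
theorem lintegral_sq_V_le (hδ : δ ≠ 1) (hη : η ∈ I) (hy : MemL2 y) :
    ∫⁻ t in I, ‖V δ η y t‖ₑ ^ 2 ≤ ENNReal.ofReal (F δ η) * ∫⁻ t in I, ‖y t‖ₑ ^ 2 := by
  have h1δ : 1 - δ ≠ 0 := sub_ne_zero.2 hδ.symm
  have h1δ' : δ - 1 ≠ 0 := sub_ne_zero.2 hδ
  have hY0 : 0 ≤ ∫ s in (0 : ℝ)..1, y s ^ 2 :=
    intervalIntegral.integral_nonneg zero_le_one fun s _ => sq_nonneg _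
  have hY : ∫⁻ t in I, ‖y t‖ₑ ^ 2 = ENNReal.ofReal (∫ s in (0 : ℝ)..1, y s ^ 2) := by
    rw [← setLIntegral_ofReal_eq zero_le_one (hy.intervalIntegrable_sq zero_mem_I one_mem_I)
      fun s _ => sq_nonneg _]
    simp only [enorm_sq_eq]
  rw [hY]
  set Y := ∫ s in (0 : ℝ)..1, y s ^ 2
  have hη0 := hη.1
  have hη1 := sub_nonneg.2 hη.2
  have hleft : ∫⁻ t in Icc 0 η, ‖V δ η y t‖ₑ ^ 2
      ≤ ENNReal.ofReal (η ^ 2 / 2 + η * ((1 / (1 - δ)) ^ 2 * (1 - η))) * ENNReal.ofReal Y := by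
    have hint : ∫ t in (0 : ℝ)..η, ((η - t) + (1 / (1 - δ)) ^ 2 * (1 - η))
        = η ^ 2 / 2 + η * ((1 / (1 - δ)) ^ 2 * (1 - η)) := by
      rw [intervalIntegral.integral_add (Continuous.intervalIntegrable (by fun_prop) _ _) (by simp),
        intervalIntegral.integral_sub (by simp) (by simp)]
      simp only [intervalIntegral.integral_const, integral_id, smul_eq_mul]
      ring
    rw [← hint, ← setLIntegral_ofReal_eq hη0 (Continuous.intervalIntegrable (by fun_prop) _ _)
      fun t ht => add_nonneg (sub_nonneg.2 ht.2) (by positivity),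
      ← lintegral_mul_const _ (by fun_prop)]
    refine setLIntegral_mono' measurableSet_Icc fun t ht => ?_
    rw [enorm_sq_eq, ← ENNReal.ofReal_mul' hY0]
    exact ENNReal.ofReal_le_ofReal (sq_V_le_left hδ hη hy ht)
  have hright : ∫⁻ t in Icc η 1, ‖V δ η y t‖ₑ ^ 2
      ≤ ENNReal.ofReal (((δ / (1 - δ)) ^ 2 + (1 / (1 - δ)) ^ 2) * ((1 - η) ^ 2 / 2))
        * ENNReal.ofReal Y := by
    have hint : ∫ t in η..1, ((δ / (1 - δ)) ^ 2 * (t - η) + (1 / (1 - δ)) ^ 2 * (1 - t))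
        = ((δ / (1 - δ)) ^ 2 + (1 / (1 - δ)) ^ 2) * ((1 - η) ^ 2 / 2) := by
      rw [intervalIntegral.integral_add (Continuous.intervalIntegrable (by fun_prop) _ _)
        (Continuous.intervalIntegrable (by fun_prop) _ _), intervalIntegral.integral_const_mul,
        intervalIntegral.integral_const_mul, intervalIntegral.integral_sub (by simp) (by simp),
        intervalIntegral.integral_sub (by simp) (by simp)]
      simp only [intervalIntegral.integral_const, integral_id, smul_eq_mul]
      ring
    rw [← hint, ← setLIntegral_ofReal_eq hη.2 (Continuous.intervalIntegrable (by fun_prop) _ _)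
      fun t ht => add_nonneg (mul_nonneg (sq_nonneg _) (sub_nonneg.2 ht.1.le))
        (mul_nonneg (sq_nonneg _) (sub_nonneg.2 ht.2)),
      ← lintegral_mul_const _ (by fun_prop)]
    refine setLIntegral_mono' measurableSet_Icc fun t ht => ?_
    rw [enorm_sq_eq, ← ENNReal.ofReal_mul' hY0]
    exact ENNReal.ofReal_le_ofReal (sq_V_le_right hδ hη hy ht)
  calc ∫⁻ t in I, ‖V δ η y t‖ₑ ^ 2
      ≤ (∫⁻ t in Icc 0 η, ‖V δ η y t‖ₑ ^ 2) + ∫⁻ t in Icc η 1, ‖V δ η y t‖ₑ ^ 2 := by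
        rw [I, ← Icc_union_Icc_eq_Icc hη.1 hη.2]
        exact lintegral_union_le _ _ _
    _ ≤ _ := add_le_add hleft hright
    _ = ENNReal.ofReal (F δ η) * ENNReal.ofReal Y := by
        rw [← add_mul, ← ENNReal.ofReal_add (by positivity) (by positivity)]
        congr 2
        rw [F, show (1 - δ) = -(δ - 1) by ring]
        field_simp
        ring

theorem F_nonneg (δ : ℝ) {η : ℝ} (hη : η ∈ I) : 0 ≤ F δ η := by
  rw [F]
  refine mul_nonneg (by positivity) ?_
  -- The bracket equals `(δ-1)²η² + δ²(1-η)² + (1-η²)`.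
  nlinarith [mul_nonneg (sq_nonneg (δ - 1)) (sq_nonneg η), mul_nonneg (sq_nonneg δ) (sq_nonneg (1 - η)),
    hη.1, hη.2]

theorem C_nonneg (δ η : ℝ) : 0 ≤ C δ η := by
  have := Real.pi_pos
  unfold C
  split_ifs <;> positivity

theorem eLpNorm_two_le_of_lintegral_le {f g : ℝ → ℝ} {μ : Measure ℝ} {c : ℝ} (hc : 0 ≤ c)
    (h : ∫⁻ t, ‖f t‖ₑ ^ 2 ∂μ ≤ ENNReal.ofReal (c ^ 2) * ∫⁻ t, ‖g t‖ₑ ^ 2 ∂μ) :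
    eLpNorm f 2 μ ≤ ENNReal.ofReal c * eLpNorm g 2 μ := by
  have key : ∀ u : ℝ → ℝ, eLpNorm u 2 μ ^ 2 = ∫⁻ t, ‖u t‖ₑ ^ 2 ∂μ := fun u => by
    simpa using eLpNorm_nnreal_pow_eq_lintegral (f := u) (μ := μ) (p := 2) two_ne_zero
  rw [← ENNReal.pow_le_pow_left_iff two_ne_zero, mul_pow, key, key, ← ENNReal.ofReal_pow hc]
  exact h

theorem eLpNorm_V_le (hδ : δ ≠ 1) (hη : η ∈ I) (hy : MemL2 y) :
    eLpNorm (V δ η y) 2 (volume.restrict I)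
      ≤ ENNReal.ofReal (C δ η) * eLpNorm y 2 (volume.restrict I) := by
  have h1 : eLpNorm (V δ η y) 2 (volume.restrict I)
      ≤ ENNReal.ofReal (Real.sqrt (F δ η)) * eLpNorm y 2 (volume.restrict I) := by
    apply eLpNorm_two_le_of_lintegral_le (Real.sqrt_nonneg _)
    rw [Real.sq_sqrt (F_nonneg δ hη)]
    exact lintegral_sq_V_le hδ hη hy
  unfold C
  split_ifs with h
  · obtain ⟨ξ, hξ, h0⟩ := exists_V_eq_zero h hη hy
    have := Real.pi_pos
    rcases min_choice (Real.sqrt (F δ η)) (2 / Real.pi) with h2 | h2 <;> rw [h2]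
    · exact h1
    · exact eLpNorm_two_le_of_lintegral_le (by positivity) (lintegral_sq_V_le_of_eq_zero hξ hy h0)
  · exact h1

theorem eLpNorm_mul_X_le {ℓ : ℝ} {k : ℝ → ℝ} (hk : MemZ ℓ fun t => k t ^ 2) (hl : 0 ≤ ℓ)
    (δ η : ℝ) (hy : MemL2 y) :
    eLpNorm (fun t => |k t| * |X δ η y t|) 2 (volume.restrict I)
      ≤ ENNReal.ofReal (2 * Real.sqrt ℓ) * eLpNorm (V δ η y) 2 (volume.restrict I) := by
  apply eLpNorm_two_le_of_lintegral_le (by positivity)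
  rw [mul_pow, Real.sq_sqrt hl]
  norm_num only
  simpa [enorm_sq_eq, ENNReal.ofReal_mul, mul_pow, sq_nonneg] using
    lintegral_mul_sq_X_le hk hl δ η hy

/-- Only `k²` is known to be measurable, so `|k| = √(k²)` replaces `k` in the norm estimates. -/
theorem aestronglyMeasurable_abs_of_memZ {ℓ : ℝ} {k : ℝ → ℝ} (hk : MemZ ℓ fun t => k t ^ 2) :
    AEStronglyMeasurable (fun t => |k t|) (volume.restrict I) := by
  have := hk.aemeasurable.sqrt
  simp only [Real.sqrt_sq_eq_abs] at this
  exact this.aestronglyMeasurable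

/-- The `L²` bound for functions dominated by a solution and its first two derivatives. -/
theorem eLpNorm_le_of_abs_le (hδ : δ ≠ 1) (hη : η ∈ I) (hy : MemL2 y) {ℓ K₂ K₃ : ℝ}
    {k f a : ℝ → ℝ} (hk : MemZ ℓ fun t => k t ^ 2) (hl : 0 ≤ ℓ) (hK₂ : 0 ≤ K₂) (hK₃ : 0 ≤ K₃)
    (ha : MemL2 a)
    (hf : ∀ᵐ t ∂(volume.restrict I),
      |f t| ≤ k t * |X δ η y t| + K₂ * |V δ η y t| + K₃ * |y t| + a t) :
    eLpNorm f 2 (volume.restrict I)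
      ≤ ENNReal.ofReal ((2 * Real.sqrt ℓ + K₂) * C δ η + K₃) * eLpNorm y 2 (volume.restrict I)
        + eLpNorm a 2 (volume.restrict I) := by
  set μ := volume.restrict I
  have hC := C_nonneg δ η
  have hX : AEStronglyMeasurable (X δ η y) μ :=
    (X_continuousOn δ η hy).aestronglyMeasurable measurableSet_Icc
  have hV : AEStronglyMeasurable (V δ η y) μ :=
    (V_continuousOn δ η hy).aestronglyMeasurable measurableSet_Icc
  have hym : AEStronglyMeasurable y μ := hy.aestronglyMeasurable
  have h1 : AEStronglyMeasurable (fun t => |k t| * |X δ η y t|) μ :=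
    (aestronglyMeasurable_abs_of_memZ hk).mul hX.norm
  have h2 : AEStronglyMeasurable (fun t => K₂ * |V δ η y t|) μ := hV.norm.const_mul _
  have h3 : AEStronglyMeasurable (fun t => K₃ * |y t|) μ := hym.norm.const_mul _
  have hc : ∀ (K : ℝ) (u : ℝ → ℝ), 0 ≤ K →
      eLpNorm (fun t => K * |u t|) 2 μ = ENNReal.ofReal K * eLpNorm u 2 μ := fun K u hK => by
    rw [← eLpNorm_norm u, ← Real.enorm_of_nonneg hK, ← eLpNorm_const_smul]
    rfl
  calc eLpNorm f 2 μ
      ≤ eLpNorm ((((fun t => |k t| * |X δ η y t|) + fun t => K₂ * |V δ η y t|)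
          + fun t => K₃ * |y t|) + a) 2 μ := by
        refine eLpNorm_mono_ae_real (hf.mono fun t ht => ht.trans ?_)
        simp only [Pi.add_apply]
        gcongr
        exact le_abs_self _
    _ ≤ eLpNorm (fun t => |k t| * |X δ η y t|) 2 μ + eLpNorm (fun t => K₂ * |V δ η y t|) 2 μ
          + eLpNorm (fun t => K₃ * |y t|) 2 μ + eLpNorm a 2 μ := by
        refine (eLpNorm_add_le ((h1.add h2).add h3) ha.aestronglyMeasurable one_le_two).trans ?_
        gcongr
        refine (eLpNorm_add_le (h1.add h2) h3 one_le_two).trans ?_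
        gcongr
        exact eLpNorm_add_le h1 h2 one_le_two
    _ ≤ ENNReal.ofReal (2 * Real.sqrt ℓ) * (ENNReal.ofReal (C δ η) * eLpNorm y 2 μ)
          + ENNReal.ofReal K₂ * (ENNReal.ofReal (C δ η) * eLpNorm y 2 μ)
          + ENNReal.ofReal K₃ * eLpNorm y 2 μ + eLpNorm a 2 μ := by
        rw [hc _ _ hK₂, hc _ _ hK₃]
        gcongr
        · exact (eLpNorm_mul_X_le hk hl δ η hy).trans
            (mul_le_mul_right (eLpNorm_V_le hδ hη hy) _)
        · exact eLpNorm_V_le hδ hη hy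
    _ = _ := by
        rw [ENNReal.ofReal_add (by positivity) hK₃,
          ENNReal.ofReal_mul (p := 2 * Real.sqrt ℓ + K₂) (by positivity),
          ENNReal.ofReal_add (by positivity) hK₂]
        ring

/-! ### The nonlinear operator and its fixed point -/

variable {g : ℝ → ℝ → ℝ → ℝ → ℝ}

/-- Projecting the time variable onto `[0,1]` extends `g` continuously to all times without changing
it on `[0,1]`. -/
theorem aestronglyMeasurable_superposition
    (hg : ContinuousOn (fun p : ℝ × ℝ × ℝ × ℝ => g p.1 p.2.1 p.2.2.1 p.2.2.2) (I ×ˢ univ))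
    (hy : MemL2 y) :
    AEStronglyMeasurable (fun t => g t (X δ η y t) (V δ η y t) (y t)) (volume.restrict I) := by
  have hcont : Continuous fun p : ℝ × ℝ × ℝ × ℝ =>
      g (projIcc (0 : ℝ) 1 zero_le_one p.1) p.2.1 p.2.2.1 p.2.2.2 :=
    hg.comp_continuous
      (f := fun p : ℝ × ℝ × ℝ × ℝ => ((projIcc (0 : ℝ) 1 zero_le_one p.1 : ℝ), p.2))
      (by fun_prop) fun p => ⟨(projIcc (0 : ℝ) 1 zero_le_one p.1).2, mem_univ _⟩
  have hm : AEStronglyMeasurable (fun t => (t, X δ η y t, V δ η y t, y t)) (volume.restrict I) :=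
    aestronglyMeasurable_id.prodMk
      (((X_continuousOn δ η hy).aestronglyMeasurable measurableSet_Icc).prodMk
        (((V_continuousOn δ η hy).aestronglyMeasurable measurableSet_Icc).prodMk
          hy.aestronglyMeasurable))
  refine (hcont.comp_aestronglyMeasurable hm).congr ?_
  filter_upwards [ae_restrict_mem measurableSet_Icc] with t ht
  rw [projIcc_of_mem zero_le_one ht]

theorem memL2_zero : MemL2 fun _ => 0 := MemLp.zero

theorem H2.eLpNorm_superposition_le (hδ : δ ≠ 1) (hη : η ∈ I) (h : H2 δ η g) :
    ∃ α b : ℝ, α < 1 ∧ 0 ≤ α ∧ 0 ≤ b ∧ ∀ y, MemL2 y →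
      eLpNorm (fun t => g t (X δ η y t) (V δ η y t) (y t)) 2 (volume.restrict I)
        ≤ ENNReal.ofReal α * eLpNorm y 2 (volume.restrict I) + ENNReal.ofReal b := by
  obtain ⟨A₂, A₃, m, a₁, a₄, hA₂, hA₃, hm, ha₁, ha₄, hlt, hbd⟩ := h
  refine ⟨_, (eLpNorm a₄ 2 (volume.restrict I)).toReal, hlt, ?_, ENNReal.toReal_nonneg,
    fun y hy => ?_⟩
  · have := C_nonneg δ η
    positivity
  · rw [ENNReal.ofReal_toReal ha₄.eLpNorm_ne_top]
    refine eLpNorm_le_of_abs_le hδ hη hy ha₁ hm hA₂ hA₃ ha₄ ?_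
    filter_upwards [ae_restrict_mem measurableSet_Icc] with t ht
    exact hbd t ht _ _ _

/-- By linearity of `X` and `V`, the growth estimate applies to `y - z` with zero inhomogeneity. -/
theorem H1.eLpNorm_superposition_sub_le (hδ : δ ≠ 1) (hη : η ∈ I) (h : H1 δ η g) (hy : MemL2 y)
    (hz : MemL2 z) :
    eLpNorm (fun t => g t (X δ η y t) (V δ η y t) (y t) - g t (X δ η z t) (V δ η z t) (z t)) 2
      (volume.restrict I) ≤ eLpNorm (fun t => y t - z t) 2 (volume.restrict I) := by
  obtain ⟨K₂, K₃, ℓ, k₁, hK₂, hK₃, hl, hk, hlip, hle⟩ := h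
  have key := eLpNorm_le_of_abs_le (y := fun t => y t - z t)
    (f := fun t => g t (X δ η y t) (V δ η y t) (y t) - g t (X δ η z t) (V δ η z t) (z t))
    hδ hη (MemLp.sub hy hz) hk hl hK₂ hK₃ memL2_zero ?_
  · rw [eLpNorm_zero', add_zero] at key
    refine key.trans ?_
    calc _ ≤ ENNReal.ofReal 1 * eLpNorm (fun t => y t - z t) 2 (volume.restrict I) := by gcongr
      _ = _ := by simp
  · filter_upwards [ae_restrict_mem measurableSet_Icc] with t ht
    rw [X_sub δ hη hy hz ht, V_sub δ hη hy hz ht, add_zero]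
    exact hlip t ht _ _ _ _ _ _

theorem exists_memL2_superposition_eq (hδ : δ ≠ 1) (hη : η ∈ I)
    (hg : ContinuousOn (fun p : ℝ × ℝ × ℝ × ℝ => g p.1 p.2.1 p.2.2.1 p.2.2.2) (I ×ˢ univ))
    (hH1 : H1 δ η g) (hH2 : H2 δ η g) :
    ∃ y, MemL2 y ∧ ∀ᵐ t ∂(volume.restrict I), y t = g t (X δ η y t) (V δ η y t) (y t) := by
  obtain ⟨α, b, hα, hα0, hb, hbd⟩ := hH2.eLpNorm_superposition_le hδ hη
  have hL : ∀ y : Lp ℝ 2 (volume.restrict I), MemL2 y := fun y => Lp.memLp y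
  have hmem : ∀ y : Lp ℝ 2 (volume.restrict I),
      MemLp (fun t => g t (X δ η y t) (V δ η y t) (y t)) 2 (volume.restrict I) := fun y =>
    ⟨aestronglyMeasurable_superposition hg (hL y), (hbd y (hL y)).trans_lt
      (ENNReal.add_lt_top.2 ⟨ENNReal.mul_lt_top ENNReal.ofReal_lt_top (Lp.eLpNorm_lt_top y),
        ENNReal.ofReal_lt_top⟩)⟩
  set N : Lp ℝ 2 (volume.restrict I) → Lp ℝ 2 (volume.restrict I) := fun y =>
    MemLp.toLp _ (hmem y) with hN
  have hLip : LipschitzWith 1 N := by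
    refine LipschitzWith.of_dist_le_mul fun y z => ?_
    rw [NNReal.coe_one, one_mul, dist_eq_norm, dist_eq_norm, hN]
    simp only
    rw [← MemLp.toLp_sub, Lp.norm_toLp, Lp.norm_def]
    refine ENNReal.toReal_mono (Lp.memLp (y - z)).eLpNorm_ne_top ?_
    rw [eLpNorm_congr_ae (Lp.coeFn_sub y z)]
    exact hH1.eLpNorm_superposition_sub_le hδ hη (hL y) (hL z)
  have hgrowth : ∀ y, ‖N y‖ ≤ α * ‖y‖ + b := by
    intro y
    rw [hN]
    simp only
    rw [Lp.norm_toLp]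
    refine ENNReal.toReal_le_of_le_ofReal (by positivity) ((hbd y (hL y)).trans_eq ?_)
    rw [ENNReal.ofReal_add (by positivity) hb, ENNReal.ofReal_mul hα0, Lp.norm_def,
      ENNReal.ofReal_toReal (hL y).eLpNorm_ne_top]
  obtain ⟨y, hy⟩ := exists_fixedPoint_of_nonexpansive N hLip hα hgrowth
  refine ⟨y, hL y, ?_⟩
  have h := MemLp.coeFn_toLp (hmem y)
  rw [show MemLp.toLp _ (hmem y) = y from hy] at h
  exact h

/-! ### Regularity of the solution -/

theorem D_X (δ η : ℝ) (hy : MemL2 y) : EqOn (D (X δ η y)) (V δ η y) I := fun t ht =>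
  (X_hasDerivWithinAt δ η hy ht).derivWithin (uniqueDiffOn_Icc zero_lt_one t ht)

theorem D_D_X (δ η : ℝ) (hy : MemL2 y) :
    ∀ᵐ t ∂(volume.restrict I), D (D (X δ η y)) t = y t := by
  have h := (hy.intervalIntegrable zero_mem_I one_mem_I).ae_hasDerivAt_integral
  rw [uIcc_of_le zero_le_one] at h
  filter_upwards [ae_restrict_of_ae h, ae_restrict_mem measurableSet_Icc] with t h ht
  have h1 : HasDerivWithinAt (V δ η y) (y t) I t :=
    ((h ht 0 zero_mem_I).const_add _).hasDerivWithinAt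
  exact (h1.congr (D_X δ η hy) (D_X δ η hy ht)).derivWithin
    (uniqueDiffOn_Icc zero_lt_one t ht)

theorem X_contDiffOn (δ η : ℝ) (hy : MemL2 y) : ContDiffOn ℝ 1 (X δ η y) I := by
  rw [contDiffOn_one_iff_derivWithin (uniqueDiffOn_Icc zero_lt_one)]
  exact ⟨fun t ht => (X_hasDerivWithinAt δ η hy ht).differentiableWithinAt,
    (V_continuousOn δ η hy).congr (D_X δ η hy)⟩

/-- Needed because `D (X δ η y)` is identified with `V δ η y` only on `[0,1]`. -/
theorem absolutelyContinuousOnInterval_congr {f h : ℝ → ℝ} {a b : ℝ}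
    (hf : AbsolutelyContinuousOnInterval f a b) (hfh : EqOn h f (uIcc a b)) :
    AbsolutelyContinuousOnInterval h a b := by
  rw [absolutelyContinuousOnInterval_iff] at hf ⊢
  intro ε hε
  obtain ⟨r, hr, H⟩ := hf ε hε
  refine ⟨r, hr, fun E hE hlt => lt_of_eq_of_lt ?_ (H E hE hlt)⟩
  refine Finset.sum_congr rfl fun i hi => ?_
  have := hE.1 i hi
  rw [hfh this.1, hfh this.2]

theorem X_memW22 (δ η : ℝ) (hy : MemL2 y) : MemW22 (X δ η y) where
  differentiableOn t ht := (X_hasDerivWithinAt δ η hy ht).differentiableWithinAt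
  absCont := ContDiffOn.absolutelyContinuousOnInterval
    (by rw [uIcc_of_le zero_le_one]; exact X_contDiffOn δ η hy)
  absCont_deriv := absolutelyContinuousOnInterval_congr (V_absolutelyContinuous δ η hy)
    (by rw [uIcc_of_le zero_le_one]; exact D_X δ η hy)
  memL2_deriv2 := (memLp_congr_ae (D_D_X δ η hy)).2 hy

end ThreePointBVP

theorem mainTheorem3 (δ η : ℝ) (hδ : δ ≠ 1) (hη : η ∈ Set.Ioo (0 : ℝ) 1)
    (g : ℝ → ℝ → ℝ → ℝ → ℝ)
    (hg : ContinuousOn (fun p : ℝ × ℝ × ℝ × ℝ => g p.1 p.2.1 p.2.2.1 p.2.2.2)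
      (Set.Icc (0 : ℝ) 1 ×ˢ Set.univ))
    (hH1 : ThreePointBVP.H1 δ η g) (hH2 : ThreePointBVP.H2 δ η g) :
    ∃ x : ℝ → ℝ, ThreePointBVP.IsSolution δ η g x ∧ ContDiffOn ℝ 1 x (Set.Icc (0 : ℝ) 1) := by
  open ThreePointBVP in
  have hηI : η ∈ I := Ioo_subset_Icc_self hη
  obtain ⟨y, hy, heq⟩ := exists_memL2_superposition_eq hδ hηI hg hH1 hH2
  refine ⟨X δ η y, ⟨X_memW22 δ η hy, ?_, ?_, ?_⟩, X_contDiffOn δ η hy⟩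
  · filter_upwards [heq, D_D_X δ η hy, ae_restrict_mem measurableSet_Icc] with t h1 h2 ht
    rw [h2, D_X δ η hy ht, ← h1, sub_self]
  · simp [X]
  · rw [D_X δ η hy one_mem_I, D_X δ η hy hηI, V_one hδ]
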